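/- Let $G$ be a (finite-dimensional, real, smooth) Lie group with Lie algebra $\mathfrak g=T_eG$, let $\pi:T^*G\to G$ be its cotangent bundle, and for $g\in G$ let $\mu_g(x)=gx$ and $\mu^g(x)=xg$ be the left and right translations. Let $\kappa^l,\kappa^r\in\Omega^1(G,\mathfrak g)$ be the left and right Maurer–Cartan forms, $\kappa^l_g=T_g(\mu_{g^{-1}})$ and $\kappa^r_g=T_g(\mu^{g^{-1}}):T_gG\to\mathfrak g$, and let $\zeta^l,\zeta^r:T^*G\to\mathfrak g^*$ be the left and right momentum maps, given on $T_g^*G$ by $\zeta^l_g=((\kappa^r_g)^{-1})^*$ and $\zeta^r_g=((\kappa^l_g)^{-1})^*$. Let $\Theta$ be the canonical Liouville form on $T^*G$, $\Theta_\xi(\Xi)=\langle \xi, T_\xi\pi(\Xi)\rangle$ for $\xi\in T^*G$ and $\Xi\in T_\xi(T^*G)$, and let $\omega=d\Theta$ be the canonical symplectic form. For a function $f$ with values in $\mathfrak g^*$ and a $1$-form $\Psi$ with values in $\mathfrak g$ let $\langle f,\Psi\rangle$ be the $1$-form $X\mapsto\langle f,\Psi(X)\rangle$, and for a $1$-form $\Phi$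 with values in $\mathfrak g^*$ let $\langle\Phi,\Psi\rangle^\wedge(X,Y)=\langle\Phi(X),\Psi(Y)\rangle-\langle\Phi(Y),\Psi(X)\rangle$. Then $\Theta$, $\zeta^l$ and $\zeta^r$ are smooth, $$\Theta=\langle\zeta^l,\pi^*\kappa^r\rangle=\langle\zeta^r,\pi^*\kappa^l\rangle,$$ and $$\omega=d\Theta=\tfrac12\left(\langle d\zeta^l,\pi^*\kappa^r\rangle^\wedge+\langle d\zeta^r,\pi^*\kappa^l\rangle^\wedge\right).$$ -/

import Mathlib

open scoped Manifold ContDiff Bundle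

noncomputable section

namespace LieCotangent

section Manifold

variable {E : Type*} [NormedAddCommGroup E] [NormedSpace ℝ E]
  {H : Type*} [TopologicalSpace H] (I : ModelWithCorners ℝ E H)
  (M : Type*) [TopologicalSpace M] [ChartedSpace H M]
  {F : Type*} [NormedAddCommGroup F] [NormedSpace ℝ F]

/-- Differential one-forms on `M` with values in `F` (fields of linear maps; smoothness is the
separate predicate `IsSmoothOneForm`). -/
abbrev OneForm (F : Type*) [NormedAddCommGroup F] [NormedSpace ℝ F] : Type _ :=
  ∀ x : M, TangentSpace I x →L[ℝ] F

/-- Differential two-forms on `M` with values in `F` (fields of alternating bilinear maps). -/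
abbrev TwoForm (F : Type*) [NormedAddCommGroup F] [NormedSpace ℝ F] : Type _ :=
  ∀ x : M, TangentSpace I x [⋀^Fin 2]→L[ℝ] F

/-- The fibre `T*_x M` of the cotangent bundle. -/
abbrev CotangentSpace (x : M) : Type _ := TangentSpace I x →L[ℝ] ℝ

/-- The cotangent bundle `T*M`, with the topology and the charts that Mathlib puts on the bundle
of continuous linear maps from the tangent bundle to the trivial line bundle. -/
abbrev CotangentBundle : Type _ := Bundle.TotalSpace (E →L[ℝ] ℝ) (CotangentSpace I M)

variable {M}

/-- The model with corners of the manifold `T*M`. -/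
abbrev cotangentModel : ModelWithCorners ℝ (E × (E →L[ℝ] ℝ)) (ModelProd H (E →L[ℝ] ℝ)) :=
  I.prod 𝓘(ℝ, E →L[ℝ] ℝ)

/-- A real one-form is smooth when it is a smooth section of the cotangent bundle. -/
def IsSmoothOneForm [IsManifold I 1 M] (α : OneForm I M ℝ) : Prop :=
  ContMDiff I (cotangentModel I) ∞ (fun x : M => (⟨x, α x⟩ : CotangentBundle I M))

/-- The exterior derivative of a one-form, computed at `x` in the chart of `M` around `x`: pull the
form back by the inverse of the chart, take the exterior derivative in the model vector space, and
pull the result back by the chart. -/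
def extDerivOneForm (α : OneForm I M F) : TwoForm I M F := fun x =>
  (extDerivWithin (𝕜 := ℝ) (E := E) (F := F) (n := 1)
      (fun y : E => ContinuousAlternatingMap.ofSubsingleton ℝ E F (0 : Fin 1)
        ((α ((extChartAt I x).symm y)).comp
          (mfderivWithin 𝓘(ℝ, E) I (extChartAt I x).symm (Set.range I) y)))
      (Set.range I) (extChartAt I x x)).compContinuousLinearMap
    (mfderiv I 𝓘(ℝ, E) (extChartAt I x) x)

/-- The exterior derivative of a function with values in a vector space: the one-form given by its
differential. -/
def extDerivFunction (f : M → F) : OneForm I M F := fun x => mvfderiv I f x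

variable {I}

/-- The pullback of a one-form along a map: `(f^* α)_x = α_{f x} ∘ T_x f`. -/
def OneForm.pullback {E' : Type*} [NormedAddCommGroup E'] [NormedSpace ℝ E']
    {H' : Type*} [TopologicalSpace H'] {J : ModelWithCorners ℝ E' H'}
    {N : Type*} [TopologicalSpace N] [ChartedSpace H' N] (f : N → M)
    (α : OneForm I M F) : OneForm J N F := fun x => (α (f x)).comp (mfderiv J I f x)

/-- The pairing `⟨f, α⟩` of a function `f` with values in `V*` and a one-form `α` with values in
`V`: the real one-form `X ↦ ⟨f, α(X)⟩`. -/
def pairing (f : M → (F →L[ℝ] ℝ)) (α : OneForm I M F) : OneForm I M ℝ := fun x => (f x).comp (α x)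

/-- The product `⟨Φ, Ψ⟩^∧` of a one-form `Φ` with values in `V*` and a one-form `Ψ` with values in
`V`: the two-form `(X, Y) ↦ ⟨Φ X, Ψ Y⟩ - ⟨Φ Y, Ψ X⟩`. -/
def wedgePairing (Φ : OneForm I M (F →L[ℝ] ℝ)) (Ψ : OneForm I M F) : TwoForm I M ℝ := fun x =>
  { toFun := fun v => Φ x (v 0) (Ψ x (v 1)) - Φ x (v 1) (Ψ x (v 0))
    map_update_add' := by
      intro d v i X Y
      fin_cases i <;> simp <;> ring
    map_update_smul' := by
      intro d v i c X
      fin_cases i <;> simp <;> ring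
    map_eq_zero_of_eq' := by
      intro v i j hv hij
      fin_cases i <;> fin_cases j <;> simp_all
    cont := by fun_prop }

variable (I M)

/-- The canonical projection `π : T*M → M`. -/
def cotangentProj : CotangentBundle I M → M := fun ξ => ξ.1

/-- The canonical Liouville form `Θ` on `T*M`: `Θ_ξ(Ξ) = ⟨ξ, T_ξ π (Ξ)⟩`. -/
def liouvilleForm [IsManifold I 1 M] : OneForm (cotangentModel I) (CotangentBundle I M) ℝ :=
  fun ξ => ξ.2.comp (mfderiv (cotangentModel I) I (cotangentProj I M) ξ)

/-- The canonical symplectic form `ω = dΘ` on `T*M`. -/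
def canonicalSymplecticForm [IsManifold I 1 M] :
    TwoForm (cotangentModel I) (CotangentBundle I M) ℝ :=
  extDerivOneForm (cotangentModel I) (liouvilleForm I M)

end Manifold

section Group

variable {E : Type*} [NormedAddCommGroup E] [NormedSpace ℝ E]
  {H : Type*} [TopologicalSpace H] (I : ModelWithCorners ℝ E H)
  (G : Type*) [TopologicalSpace G] [ChartedSpace H G] [Group G]

/-- The left Maurer-Cartan form `κ^l_g = T_g(x ↦ g⁻¹ x) : T_g G → 𝔤`. In Mathlib every tangent
space of `G`, and in particular `𝔤 = T_1 G`, is the model space `E` by definition. -/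
def maurerCartanLeft : OneForm I G E := fun g =>
  (mfderiv I I (fun x : G => g⁻¹ * x) g : TangentSpace I g →L[ℝ] TangentSpace I (g⁻¹ * g))

/-- The right Maurer-Cartan form `κ^r_g = T_g(x ↦ x g⁻¹) : T_g G → 𝔤`. -/
def maurerCartanRight : OneForm I G E := fun g =>
  (mfderiv I I (fun x : G => x * g⁻¹) g : TangentSpace I g →L[ℝ] TangentSpace I (g * g⁻¹))

/-- The left momentum map `ζ^l : T*G → 𝔤*`, `ζ^l_g = ((κ^r_g)⁻¹)^*`. Since `𝔤 = T_1 G` is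
`E` by definition, `𝔤*` is `E →L[ℝ] ℝ`. -/
def momentumLeft (ξ : CotangentBundle I G) : E →L[ℝ] ℝ :=
  ξ.2.comp (maurerCartanRight I G ξ.1).inverse

/-- The right momentum map `ζ^r : T*G → 𝔤*`, `ζ^r_g = ((κ^l_g)⁻¹)^*`. -/
def momentumRight (ξ : CotangentBundle I G) : E →L[ℝ] ℝ :=
  ξ.2.comp (maurerCartanLeft I G ξ.1).inverse

end Group

end LieCotangent

end

noncomputable section

namespace LieCotangent

section OneForms

open Set Filter Topology

variable {E : Type*} [NormedAddCommGroup E] [NormedSpace ℝ E]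
  {H : Type*} [TopologicalSpace H] {I : ModelWithCorners ℝ E H}
  {M : Type*} [TopologicalSpace M] [ChartedSpace H M]
  {E' : Type*} [NormedAddCommGroup E'] [NormedSpace ℝ E']
  {H' : Type*} [TopologicalSpace H'] {J : ModelWithCorners ℝ E' H'}
  {N : Type*} [TopologicalSpace N] [ChartedSpace H' N]
  {F : Type*} [NormedAddCommGroup F] [NormedSpace ℝ F]

/-- The one-form `α` read in the preferred chart around `x`. -/
def OneForm.inChart (α : OneForm I M F) (x : M) (y : E) : E →L[ℝ] F :=
  (α ((extChartAt I x).symm y)).comp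
    (mfderivWithin 𝓘(ℝ, E) I (extChartAt I x).symm (range I) y)

/-- A one-form is differentiable at `x` when its expression in the preferred chart is. -/
def OneForm.DiffAt (α : OneForm I M F) (x : M) : Prop :=
  DifferentiableAt ℝ (α.inChart x) (extChartAt I x x)

theorem OneForm.inChart_self [IsManifold I 1 M] (α : OneForm I M F) (x : M) :
    α.inChart x (extChartAt I x x) = (α x : E →L[ℝ] F) := by
  have h : (extChartAt I x).symm (extChartAt I x x) = x := extChartAt_to_inv x
  unfold OneForm.inChart
  rw [mfderivWithin_range_extChartAt_symm]
  change (α ((extChartAt I x).symm (extChartAt I x x)) : E →L[ℝ] F) = α x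
  rw [h]

/-- The exterior derivative of a one-form on a vector space, seen as a bilinear expression. -/
theorem extDeriv_ofSubsingleton_apply (β : E → E →L[ℝ] F) (x : E) (v : Fin 2 → E) :
    extDeriv (fun y => ContinuousAlternatingMap.ofSubsingleton ℝ E F (0 : Fin 1) (β y)) x v =
      fderiv ℝ β x (v 0) (v 1) - fderiv ℝ β x (v 1) (v 0) := by
  have h : fderiv ℝ (fun y => ContinuousAlternatingMap.ofSubsingleton ℝ E F (0 : Fin 1) (β y)) x =
      ((ContinuousAlternatingMap.ofSubsingletonLIE (𝕜 := ℝ) (E := E) (F := F) (0 : Fin 1)).toContinuousLinearEquiv :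
        (E →L[ℝ] F) →L[ℝ] _).comp (fderiv ℝ β x) :=
    (ContinuousAlternatingMap.ofSubsingletonLIE (𝕜 := ℝ) (E := E) (F := F) (0 : Fin 1)).toContinuousLinearEquiv.comp_fderiv
  rw [extDeriv, h, ContinuousAlternatingMap.alternatizeUncurryFin_apply, Fin.sum_univ_two]
  simp [ContinuousAlternatingMap.ofSubsingletonLIE, Fin.removeNth, sub_eq_add_neg]
  rfl

/-- The product rule for the exterior derivative of a pairing, on a vector space. -/
theorem fderiv_clm_comp_apply_sub {φ : E → F →L[ℝ] ℝ} {β : E → E →L[ℝ] F} {x : E}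
    (hφ : DifferentiableAt ℝ φ x) (hβ : DifferentiableAt ℝ β x) (a b : E) :
    fderiv ℝ (fun y => (φ y).comp (β y)) x a b - fderiv ℝ (fun y => (φ y).comp (β y)) x b a =
      fderiv ℝ φ x a (β x b) - fderiv ℝ φ x b (β x a) +
        φ x (fderiv ℝ β x a b - fderiv ℝ β x b a) := by
  rw [fderiv_clm_comp hφ hβ]
  simp
  ring

theorem extDerivOneForm_apply [I.Boundaryless] [IsManifold I 1 M] (α : OneForm I M F) (x : M)
    (v : Fin 2 → E) :
    (extDerivOneForm I α x : E [⋀^Fin 2]→L[ℝ] F) v =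
      fderiv ℝ (α.inChart x) (extChartAt I x x) (v 0) (v 1) -
        fderiv ℝ (α.inChart x) (extChartAt I x x) (v 1) (v 0) := by
  rw [← extDeriv_ofSubsingleton_apply, ← extDerivWithin_univ, ← I.range_eq_univ]
  unfold extDerivOneForm
  rw [mfderiv_extChartAt_self]
  rfl

theorem extDerivOneForm_pairing_apply [I.Boundaryless] [IsManifold I 1 M] {f : M → F →L[ℝ] ℝ}
    {α : OneForm I M F} {x : M} (hf : MDifferentiableAt I 𝓘(ℝ, F →L[ℝ] ℝ) f x)
    (hα : α.DiffAt x) (v : Fin 2 → E) :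
    (extDerivOneForm I (pairing f α) x : E [⋀^Fin 2]→L[ℝ] ℝ) v =
      (wedgePairing (extDerivFunction I f) α x : E [⋀^Fin 2]→L[ℝ] ℝ) v +
        f x ((extDerivOneForm I α x : E [⋀^Fin 2]→L[ℝ] F) v) := by
  have hf' : DifferentiableAt ℝ (fun y => f ((extChartAt I x).symm y)) (extChartAt I x x) := by
    have := hf.differentiableWithinAt_writtenInExtChartAt
    rw [I.range_eq_univ, differentiableWithinAt_univ] at this
    exact this
  have hdf : (extDerivFunction I f x : E →L[ℝ] (F →L[ℝ] ℝ)) =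
      fderiv ℝ (fun y => f ((extChartAt I x).symm y)) (extChartAt I x x) := by
    rw [← fderivWithin_univ, ← I.range_eq_univ]
    exact hf.mfderiv
  have hp : (pairing f α).inChart x =
      fun y => (f ((extChartAt I x).symm y)).comp (α.inChart x y) := rfl
  have hw : (wedgePairing (extDerivFunction I f) α x : E [⋀^Fin 2]→L[ℝ] ℝ) v =
      (extDerivFunction I f x : E →L[ℝ] (F →L[ℝ] ℝ)) (v 0) ((α x : E →L[ℝ] F) (v 1)) -
      (extDerivFunction I f x : E →L[ℝ] (F →L[ℝ] ℝ)) (v 1) ((α x : E →L[ℝ] F) (v 0)) := rfl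
  have hfx : f x = f ((extChartAt I x).symm (extChartAt I x x)) := by rw [extChartAt_to_inv]
  rw [extDerivOneForm_apply, extDerivOneForm_apply, hw, hdf, hp, hfx, ← α.inChart_self x]
  exact fderiv_clm_comp_apply_sub hf' hα _ _

theorem OneForm.inChart_pullback_eventuallyEq [I.Boundaryless] [J.Boundaryless] [IsManifold I 1 M]
    [IsManifold J 1 N] (α : OneForm I M F) {f : N → M} {x : N} (hf : ContMDiffAt J I 1 f x) :
    (α.pullback (J := J) f).inChart x =ᶠ[𝓝 (extChartAt J x x)]
      fun y => (α.inChart (f x) (writtenInExtChartAt J I x f y)).comp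
        (fderiv ℝ (writtenInExtChartAt J I x f) y) := by
  have hf' : ∀ᶠ q in 𝓝 x, ContMDiffAt J I 1 f q :=
    (contMDiffAt_iff_contMDiffAt_nhds (by simp)).1 hf
  have hsrc : ∀ᶠ q in 𝓝 x, f q ∈ (extChartAt I (f x)).source :=
    hf.continuousAt.eventually (extChartAt_source_mem_nhds (f x))
  have hc : Tendsto (extChartAt J x).symm (𝓝 (extChartAt J x x)) (𝓝 x) := by
    have := continuousAt_extChartAt_symm (I := J) x
    rwa [ContinuousAt, extChartAt_to_inv] at this
  filter_upwards [hc.eventually hf', hc.eventually hsrc, extChartAt_target_mem_nhds x]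
    with y hfy hsy hy
  set p := (extChartAt J x).symm y with hp
  have hdp : MDifferentiableAt 𝓘(ℝ, E') J (extChartAt J x).symm y := by
    have := mdifferentiableWithinAt_extChartAt_symm (I := J) hy
    rwa [J.range_eq_univ, mdifferentiableWithinAt_univ] at this
  have hdf : MDifferentiableAt J I f p := hfy.mdifferentiableAt one_ne_zero
  have hdψ : MDifferentiableAt I 𝓘(ℝ, E) (extChartAt I (f x)) (f p) :=
    mdifferentiableAt_extChartAt (by simpa using hsy)
  obtain ⟨A, hA⟩ : ∃ A : E →L[ℝ] E, A = mfderiv I 𝓘(ℝ, E) (extChartAt I (f x)) (f p) := ⟨_, rfl⟩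
  obtain ⟨A', hA'⟩ : ∃ A' : E →L[ℝ] E, A' = mfderivWithin 𝓘(ℝ, E) I (extChartAt I (f x)).symm
    (range I) (extChartAt I (f x) (f p)) := ⟨_, rfl⟩
  obtain ⟨B, hB⟩ : ∃ B : E' →L[ℝ] E, B = mfderiv J I f p := ⟨_, rfl⟩
  obtain ⟨C, hC⟩ : ∃ C : E' →L[ℝ] E', C = mfderiv 𝓘(ℝ, E') J (extChartAt J x).symm y :=
    ⟨_, rfl⟩
  obtain ⟨a, ha⟩ : ∃ a : E →L[ℝ] F, a = α (f p) := ⟨_, rfl⟩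
  have hF : HasFDerivAt (writtenInExtChartAt J I x f) (A.comp (B.comp C)) y := by
    rw [hA, hB, hC]
    exact hasMFDerivAt_iff_hasFDerivAt.1
      (hdψ.hasMFDerivAt.comp y (hdf.hasMFDerivAt.comp y hdp.hasMFDerivAt))
  have hinv : A'.comp A = ContinuousLinearMap.id ℝ E := by
    rw [hA, hA']
    exact mfderivWithin_extChartAt_symm_comp_mfderiv_extChartAt' hsy
  have hα : (α ((extChartAt I (f x)).symm (extChartAt I (f x) (f p))) : E →L[ℝ] F) = a := by
    rw [(extChartAt I (f x)).left_inv hsy, ha]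
  have hL : (α.pullback (J := J) f).inChart x y = (a.comp B).comp C := by
    unfold OneForm.inChart
    rw [J.range_eq_univ, mfderivWithin_univ, ha, hB, hC]
    rfl
  have hR : α.inChart (f x) (writtenInExtChartAt J I x f y) = a.comp A' := by
    rw [← hα, hA']
    rfl
  rw [hL, hR, hF.fderiv]
  ext v
  exact congrArg a (DFunLike.congr_fun hinv (B (C v))).symm

theorem OneForm.DiffAt.pullback [I.Boundaryless] [J.Boundaryless] [IsManifold I 1 M]
    [IsManifold J 1 N] {α : OneForm I M F} {f : N → M} {x : N} (hf : ContMDiffAt J I 2 f x)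
    (hα : α.DiffAt (f x)) : (α.pullback (J := J) f).DiffAt x := by
  have hF : ContDiffAt ℝ 2 (writtenInExtChartAt J I x f) (extChartAt J x x) := by
    have := (contMDiffAt_iff.1 hf).2
    rwa [J.range_eq_univ, contDiffWithinAt_univ] at this
  refine (DifferentiableAt.clm_comp ?_ ?_).congr_of_eventuallyEq
    (α.inChart_pullback_eventuallyEq (hf.of_le one_le_two))
  · refine DifferentiableAt.comp (f := writtenInExtChartAt J I x f) (g := α.inChart (f x)) _ ?_
      (hF.differentiableAt two_ne_zero)
    have : writtenInExtChartAt J I x f (extChartAt J x x) = extChartAt I (f x) (f x) := by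
      simp only [writtenInExtChartAt, Function.comp_apply, extChartAt_to_inv]
    rw [this]
    exact hα
  · exact (hF.fderiv_right (m := 1) (by norm_num)).differentiableAt one_ne_zero

theorem extDerivOneForm_pullback_apply [I.Boundaryless] [J.Boundaryless] [IsManifold I 1 M]
    [IsManifold J 1 N] {α : OneForm I M F} {f : N → M} {x : N} {z : M} (hz : f x = z)
    (hf : ContMDiffAt J I 2 f x) (hα : α.DiffAt z) {D : E' →L[ℝ] E} (hD : mfderiv J I f x = D)
    (v : Fin 2 → E') :
    (extDerivOneForm J (α.pullback (J := J) f) x : E' [⋀^Fin 2]→L[ℝ] F) v =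
      (extDerivOneForm I α z : E [⋀^Fin 2]→L[ℝ] F)
        (fun i => D (v i)) := by
  subst hz
  have hF : ContDiffAt ℝ 2 (writtenInExtChartAt J I x f) (extChartAt J x x) := by
    have := (contMDiffAt_iff.1 hf).2
    rwa [J.range_eq_univ, contDiffWithinAt_univ] at this
  have hx : writtenInExtChartAt J I x f (extChartAt J x x) = extChartAt I (f x) (f x) := by
    simp [writtenInExtChartAt]
  have hdf : (mfderiv J I f x : E' →L[ℝ] E) =
      fderiv ℝ (writtenInExtChartAt J I x f) (extChartAt J x x) := by
    rw [← fderivWithin_univ, ← J.range_eq_univ]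
    exact (hf.mdifferentiableAt two_ne_zero).mfderiv
  have hd : DifferentiableAt ℝ (fun y =>
      ContinuousAlternatingMap.ofSubsingleton ℝ E F (0 : Fin 1) (α.inChart (f x) y))
      (writtenInExtChartAt J I x f (extChartAt J x x)) := by
    rw [hx]
    exact (ContinuousAlternatingMap.ofSubsingletonLIE (𝕜 := ℝ) (E := E) (F := F)
      (0 : Fin 1)).toContinuousLinearEquiv.differentiableAt.comp _ hα
  have key := DFunLike.congr_fun (extDeriv_pullback hd hF (by simp)) v
  rw [hx, ContinuousAlternatingMap.compContinuousLinearMap_apply,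
    extDeriv_ofSubsingleton_apply] at key
  rw [← hD, hdf, extDerivOneForm_apply, extDerivOneForm_apply,
    (α.inChart_pullback_eventuallyEq (hf.of_le one_le_two)).fderiv_eq,
    ← extDeriv_ofSubsingleton_apply]
  exact key

end OneForms

section Smoothness

open Set Filter Topology

variable {E : Type*} [NormedAddCommGroup E] [NormedSpace ℝ E]
  {H : Type*} [TopologicalSpace H] {I : ModelWithCorners ℝ E H}
  {M : Type*} [TopologicalSpace M] [ChartedSpace H M]
  {E' : Type*} [NormedAddCommGroup E'] [NormedSpace ℝ E']
  {H' : Type*} [TopologicalSpace H'] {J : ModelWithCorners ℝ E' H'}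
  {N : Type*} [TopologicalSpace N] [ChartedSpace H' N]
  {F : Type*} [NormedAddCommGroup F] [NormedSpace ℝ F]

/-- A one-form with values in a vector space is smooth at `x` when its expression in the preferred
chart is. -/
def OneForm.SmoothAt (α : OneForm I M F) (x : M) : Prop :=
  ContDiffAt ℝ ∞ (α.inChart x) (extChartAt I x x)

theorem OneForm.SmoothAt.diffAt {α : OneForm I M F} {x : M} (h : α.SmoothAt x) : α.DiffAt x :=
  ContDiffAt.differentiableAt h (by simp)

theorem mfderiv_extChartAt_of_eq [IsManifold I 1 M] {x y : M} (h : x = y) :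
    (mfderiv I 𝓘(ℝ, E) (extChartAt I x) y : E →L[ℝ] E) = ContinuousLinearMap.id ℝ E := by
  subst h
  exact mfderiv_extChartAt_self

/-- If `f x x` does not depend on `x`, the derivatives of `f x` at `x` form a smooth one-form. -/
theorem OneForm.smoothAt_of_eq_mfderiv [I.Boundaryless] [IsManifold I ∞ M] [IsManifold J ∞ N]
    {f : M → M → N} {c : N} (hf : ContMDiff (I.prod I) J ∞ (Function.uncurry f))
    (hc : ∀ x, f x x = c) {α : OneForm I M E'}
    (hα : ∀ x, (α x : E →L[ℝ] E') = (mfderiv I J (f x) x : E →L[ℝ] E')) (x₀ : M) :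
    α.SmoothAt x₀ := by
  have h := (hf.contMDiffAt (x := (x₀, x₀))).mfderiv f id contMDiffAt_id (m := ∞) (by simp)
  have hs : ContMDiffAt 𝓘(ℝ, E) I ∞ (extChartAt I x₀).symm (extChartAt I x₀ x₀) :=
    (contMDiffOn_extChartAt_symm x₀).contMDiffAt (extChartAt_target_mem_nhds x₀)
  have h' := (h.comp_of_eq hs (extChartAt_to_inv x₀)).contDiffAt
  refine ContDiffAt.congr_of_eventuallyEq h' ?_
  filter_upwards [extChartAt_target_mem_nhds x₀] with y hy
  have hq : (extChartAt I x₀).symm y ∈ (chartAt H x₀).source := by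
    simpa using (extChartAt I x₀).map_target hy
  have e := inTangentCoordinates_eq_mfderiv_comp (I := I) (I' := J) (f := id) (g := fun x => f x x)
    (ϕ := fun x => mfderiv I J (f x) x) (x₀ := x₀) (x := (extChartAt I x₀).symm y) hq
    (by rw [hc, hc]; exact mem_chart_source H' c)
  refine Eq.trans ?_ e.symm
  have hid := mfderiv_extChartAt_of_eq (I := J) ((hc x₀).trans (hc ((extChartAt I x₀).symm y)).symm)
  have hy' : extChartAt I x₀ ((extChartAt I x₀).symm y) = y := (extChartAt I x₀).right_inv hy
  rw [OneForm.inChart, hα]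
  ext v
  have hv : (mfderivWithin 𝓘(ℝ, E) I (extChartAt I x₀).symm (range I) y : E →L[ℝ] E) v =
      (mfderivWithin 𝓘(ℝ, E) I (extChartAt I x₀).symm (range I)
        (extChartAt I x₀ ((extChartAt I x₀).symm y)) : E →L[ℝ] E) v := by
    rw [hy']
  refine (congrArg (mfderiv I J (f ((extChartAt I x₀).symm y)) ((extChartAt I x₀).symm y)) hv).trans
    ?_
  exact (DFunLike.congr_fun hid _).symm

variable (I) in
/-- The derivative of the inverse of the preferred chart around `x`, as an endomorphism of the model
space. -/
def chartSymmDeriv (x : M) (y : E) : E →L[ℝ] E :=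
  mfderivWithin 𝓘(ℝ, E) I (extChartAt I x).symm (range I) y

/-- A covector, as a linear form on the model space. -/
def covector (ξ : CotangentBundle I M) : E →L[ℝ] ℝ := ξ.2

theorem continuousLinearMapAt_trivial (x₀ x : M) :
    (trivializationAt ℝ (fun _ : M => ℝ) x₀).continuousLinearMapAt ℝ x =
      ContinuousLinearMap.id ℝ ℝ :=
  Bundle.Trivial.continuousLinearMapAt_trivialization ℝ M ℝ x

theorem contMDiffAt_covector_comp [IsManifold I ∞ M] (ξ₀ : CotangentBundle I M) :
    ContMDiffAt (cotangentModel I) 𝓘(ℝ, E →L[ℝ] ℝ) ∞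
      (fun ξ : CotangentBundle I M =>
        (covector ξ).comp (chartSymmDeriv I ξ₀.1 (extChartAt I ξ₀.1 ξ.1))) ξ₀ := by
  have h := ((contMDiffAt_hom_bundle (IB := I) (n := ∞) (id : CotangentBundle I M → _)
    (x₀ := ξ₀)).1 contMDiffAt_id)
  refine h.2.congr_of_eventuallyEq ?_
  have hsrc : ∀ᶠ ξ : CotangentBundle I M in 𝓝 ξ₀, ξ.1 ∈ (chartAt H ξ₀.1).source :=
    h.1.continuousAt.eventually (chart_source_mem_nhds H ξ₀.1)
  filter_upwards [hsrc] with ξ hξ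
  have := TangentBundle.symmL_trivializationAt (I := I) hξ
  simp only [id, ContinuousLinearMap.inCoordinates, this]
  rw [continuousLinearMapAt_trivial]
  rfl

theorem isSmoothOneForm_liouvilleForm [IsManifold I ∞ M] :
    IsSmoothOneForm (cotangentModel I) (liouvilleForm I M) := by
  intro ξ₀
  rw [contMDiffAt_hom_bundle]
  refine ⟨contMDiffAt_id, ?_⟩
  have hπ : ContMDiffAt (cotangentModel I) I ∞ (cotangentProj I M) ξ₀ := by
    exact ((contMDiffAt_hom_bundle (IB := I) (n := ∞) (id : CotangentBundle I M → _)
      (x₀ := ξ₀)).1 contMDiffAt_id).1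
  have h := hπ.mfderiv_const (m := ∞) (by simp)
  refine ((contMDiffAt_covector_comp ξ₀).clm_comp h).congr_of_eventuallyEq ?_
  have hsrc : ∀ᶠ ξ : CotangentBundle I M in 𝓝 ξ₀, ξ.1 ∈ (chartAt H ξ₀.1).source :=
    hπ.continuousAt.eventually (chart_source_mem_nhds H ξ₀.1)
  filter_upwards [hsrc] with ξ hξ
  have h₁ := TangentBundle.continuousLinearMapAt_trivializationAt (I := I) hξ
  have h₂ := mfderivWithin_extChartAt_symm_comp_mfderiv_extChartAt' (I := I)
    (x := ξ₀.1) (y := ξ.1) (by simpa using hξ)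
  simp only [inTangentCoordinates, ContinuousLinearMap.inCoordinates, cotangentProj, id, h₁]
  rw [continuousLinearMapAt_trivial]
  refine ContinuousLinearMap.ext fun v => ?_
  exact congrArg ξ.2 (DFunLike.congr_fun h₂ _).symm

end Smoothness

section Momentum

open Set Filter Topology

variable {E : Type*} [NormedAddCommGroup E] [NormedSpace ℝ E]
  {H : Type*} [TopologicalSpace H] {I : ModelWithCorners ℝ E H}
  {M : Type*} [TopologicalSpace M] [ChartedSpace H M]

theorem contMDiff_cotangentProj [IsManifold I ∞ M] :
    ContMDiff (cotangentModel I) I ∞ (cotangentProj I M) := fun ξ₀ =>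
  ((contMDiffAt_hom_bundle (IB := I) (n := ∞) (id : CotangentBundle I M → _)
    (x₀ := ξ₀)).1 contMDiffAt_id).1

/-- A smooth field of invertible maps `T_x M → E` yields a smooth trivialization of the cotangent
bundle. -/
theorem contMDiff_covector_comp_inverse [CompleteSpace E] [IsManifold I ∞ M] {α : OneForm I M E}
    (hs : ∀ x, α.SmoothAt x) (hi : ∀ x, (α x : E →L[ℝ] E).IsInvertible) :
    ContMDiff (cotangentModel I) 𝓘(ℝ, E →L[ℝ] ℝ) ∞
      (fun ξ : CotangentBundle I M => (covector ξ).comp (α ξ.1 : E →L[ℝ] E).inverse) := by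
  intro ξ₀
  have key : ∀ x ∈ (extChartAt I ξ₀.1).source, ∃ C : E →L[ℝ] E, C.IsInvertible ∧
      C = chartSymmDeriv I ξ₀.1 (extChartAt I ξ₀.1 x) ∧
      α.inChart ξ₀.1 (extChartAt I ξ₀.1 x) = (α x : E →L[ℝ] E).comp C := by
    intro x hx
    refine ⟨_, isInvertible_mfderivWithin_extChartAt_symm ((extChartAt I ξ₀.1).map_source hx),
      rfl, ?_⟩
    have h : (α ((extChartAt I ξ₀.1).symm (extChartAt I ξ₀.1 x)) : E →L[ℝ] E) = α x := by
      rw [(extChartAt I ξ₀.1).left_inv hx]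
    rw [← h]
    rfl
  have hK : ContMDiffAt (cotangentModel I) 𝓘(ℝ, E →L[ℝ] E) ∞
      (fun ξ : CotangentBundle I M => (α.inChart ξ₀.1 (extChartAt I ξ₀.1 ξ.1)).inverse) ξ₀ := by
    obtain ⟨C, hC, -, hC'⟩ := key ξ₀.1 (mem_extChartAt_source ξ₀.1)
    have h₁ : ContDiffAt ℝ ∞ (fun y => (α.inChart ξ₀.1 y).inverse) (extChartAt I ξ₀.1 ξ₀.1) := by
      refine ContDiffAt.comp (g := ContinuousLinearMap.inverse) _ ?_ (hs ξ₀.1)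
      refine ContinuousLinearMap.IsInvertible.contDiffAt_map_inverse ?_
      rw [hC']
      exact (hi ξ₀.1).comp hC
    have h₂ : ContMDiffAt (cotangentModel I) 𝓘(ℝ, E) ∞
        (fun ξ : CotangentBundle I M => extChartAt I ξ₀.1 ξ.1) ξ₀ :=
      (contMDiffAt_extChartAt (x := ξ₀.1)).comp ξ₀ (contMDiff_cotangentProj ξ₀)
    exact h₁.contMDiffAt.comp ξ₀ h₂
  refine ((contMDiffAt_covector_comp ξ₀).clm_comp hK).congr_of_eventuallyEq ?_
  have hsrc : ∀ᶠ ξ : CotangentBundle I M in 𝓝 ξ₀, ξ.1 ∈ (extChartAt I ξ₀.1).source :=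
    (contMDiff_cotangentProj ξ₀).continuousAt.eventually (extChartAt_source_mem_nhds ξ₀.1)
  filter_upwards [hsrc] with ξ hξ
  obtain ⟨C, hC, hC', hC''⟩ := key ξ.1 hξ
  obtain ⟨A, hA⟩ : ∃ A : E →L[ℝ] E, A = α ξ.1 := ⟨_, rfl⟩
  have h : (covector ξ).comp A.inverse = ((covector ξ).comp C).comp (A.comp C).inverse := by
    rw [hC.inverse_comp_of_right]
    ext v
    exact congrArg (covector ξ) (hC.self_apply_inverse _).symm
  rw [hC'', ← hC', ← hA]
  exact h

end Momentum

section ModelDeriv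

variable {E : Type*} [NormedAddCommGroup E] [NormedSpace ℝ E]
  {H : Type*} [TopologicalSpace H] {I : ModelWithCorners ℝ E H}
  {M : Type*} [TopologicalSpace M] [ChartedSpace H M]
  {E' : Type*} [NormedAddCommGroup E'] [NormedSpace ℝ E']
  {H' : Type*} [TopologicalSpace H'] {J : ModelWithCorners ℝ E' H'}
  {N : Type*} [TopologicalSpace N] [ChartedSpace H' N]
  {E'' : Type*} [NormedAddCommGroup E''] [NormedSpace ℝ E'']
  {H'' : Type*} [TopologicalSpace H''] {K : ModelWithCorners ℝ E'' H''}
  {P : Type*} [TopologicalSpace P] [ChartedSpace H'' P]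

variable (I J) in
/-- The differential of a map between manifolds, as a linear map between the model spaces. -/
def modelDeriv (f : M → N) (x : M) : E →L[ℝ] E' := mfderiv I J f x

theorem modelDeriv_comp {g : N → P} {f : M → N} {x : M} {y : N} (hy : f x = y)
    (hg : MDifferentiableAt J K g y) (hf : MDifferentiableAt I J f x) :
    modelDeriv I K (fun z => g (f z)) x = (modelDeriv J K g y).comp (modelDeriv I J f x) := by
  subst hy
  exact mfderiv_comp x hg hf

theorem modelDeriv_id (x : M) : modelDeriv I I (fun z : M => z) x = ContinuousLinearMap.id ℝ E :=
  mfderiv_id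

theorem modelDeriv_const (c : N) (x : M) : modelDeriv I J (fun _ : M => c) x = 0 :=
  mfderiv_const

theorem isInvertible_modelDeriv {f : M → N} {f' : N → M} (hf : MDifferentiable I J f)
    (hf' : MDifferentiable J I f') (h : ∀ x, f' (f x) = x) (h' : ∀ y, f (f' y) = y) (x : M) :
    (modelDeriv I J f x).IsInvertible := by
  refine ContinuousLinearMap.IsInvertible.of_inverse (g := modelDeriv J I f' (f x)) ?_ ?_
  · rw [← modelDeriv_comp (h x) (hf x) (hf' (f x))]
    simp only [h', modelDeriv_id]
  · rw [← modelDeriv_comp rfl (hf' (f x)) (hf x)]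
    simp only [h, modelDeriv_id]

theorem modelDeriv_comp_prodMk {m : N × P → M} {f : M → N} {g : M → P} {x : M}
    {p : N × P} (hp : (f x, g x) = p) (hm : MDifferentiableAt (J.prod K) I m p)
    (hf : MDifferentiableAt I J f x) (hg : MDifferentiableAt I K g x) :
    modelDeriv I I (fun z => m (f z, g z)) x =
      (modelDeriv J I (fun z => m (z, p.2)) p.1).comp (modelDeriv I J f x) +
        (modelDeriv K I (fun z => m (p.1, z)) p.2).comp (modelDeriv I K g x) := by
  rw [modelDeriv_comp (g := m) (f := fun z => (f z, g z)) hp hm (hf.prodMk hg)]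
  ext v
  have h₁ : modelDeriv I (J.prod K) (fun z => (f z, g z)) x v =
      (modelDeriv I J f x v, modelDeriv I K g x v) :=
    DFunLike.congr_fun (mfderiv_prodMk hf hg) v
  refine (congrArg (modelDeriv (J.prod K) I m p) h₁).trans ?_
  exact mfderiv_prod_eq_add_apply hm

end ModelDeriv

section Symmetry

variable {G : Type*} [Group G]

/-- The symmetry `x ↦ g x⁻¹ g` of a group at `g`. -/
def symmetryAt (g x : G) : G := g * x⁻¹ * g

theorem symmetryAt_self (g : G) : symmetryAt g g = g := by simp [symmetryAt]

end Symmetry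

section Group

variable {E : Type*} [NormedAddCommGroup E] [NormedSpace ℝ E]
  {H : Type*} [TopologicalSpace H] {I : ModelWithCorners ℝ E H}
  {G : Type*} [TopologicalSpace G] [ChartedSpace H G] [Group G] [LieGroup I ∞ G]

theorem smoothAt_maurerCartanLeft [I.Boundaryless] (g : G) : (maurerCartanLeft I G).SmoothAt g := by
  refine OneForm.smoothAt_of_eq_mfderiv (J := I) (f := fun g x : G => g⁻¹ * x) (c := (1 : G))
    ?_ (fun x => inv_mul_cancel x) (fun x => rfl) g
  exact (contMDiff_fst.inv).mul contMDiff_snd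

theorem smoothAt_maurerCartanRight [I.Boundaryless] (g : G) :
    (maurerCartanRight I G).SmoothAt g := by
  refine OneForm.smoothAt_of_eq_mfderiv (J := I) (f := fun g x : G => x * g⁻¹) (c := (1 : G))
    ?_ (fun x => mul_inv_cancel x) (fun x => rfl) g
  exact contMDiff_snd.mul (contMDiff_fst.inv)

theorem contMDiff_mul_left_const (a : G) : ContMDiff I I ∞ (fun x : G => a * x) :=
  contMDiff_const.mul contMDiff_id

theorem contMDiff_mul_right_const (a : G) : ContMDiff I I ∞ (fun x : G => x * a) :=
  contMDiff_id.mul contMDiff_const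

theorem isInvertible_modelDeriv_mul_left (a g : G) :
    (modelDeriv I I (fun x : G => a * x) g).IsInvertible :=
  isInvertible_modelDeriv (f := fun x : G => a * x) (f' := fun x : G => a⁻¹ * x)
    ((contMDiff_mul_left_const _).mdifferentiable (by simp))
    ((contMDiff_mul_left_const _).mdifferentiable (by simp)) (by simp) (by simp) g

theorem isInvertible_modelDeriv_mul_right (a g : G) :
    (modelDeriv I I (fun x : G => x * a) g).IsInvertible :=
  isInvertible_modelDeriv (f := fun x : G => x * a) (f' := fun x : G => x * a⁻¹)
    ((contMDiff_mul_right_const _).mdifferentiable (by simp))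
    ((contMDiff_mul_right_const _).mdifferentiable (by simp)) (by simp) (by simp) g

theorem contMDiff_symmetryAt (g : G) : ContMDiff I I ∞ (symmetryAt g) :=
  (contMDiff_const.mul (contMDiff_id.inv)).mul contMDiff_const

theorem modelDeriv_symmetryAt_self (g : G) :
    modelDeriv I I (symmetryAt g) g = -ContinuousLinearMap.id ℝ E := by
  have hm : ContMDiff (I.prod I) I ∞ (fun p : G × G => p.1 * g⁻¹ * p.2) :=
    (contMDiff_fst.mul contMDiff_const).mul contMDiff_snd
  have h := modelDeriv_comp_prodMk (m := fun p : G × G => p.1 * g⁻¹ * p.2) (f := fun z : G => z)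
    (g := symmetryAt g) (x := g) (p := (g, g)) (by rw [symmetryAt_self])
    (hm.mdifferentiable (by simp) _) mdifferentiableAt_id
    ((contMDiff_symmetryAt (I := I) g).mdifferentiable (by simp) g)
  have hc : ∀ z : G, z * g⁻¹ * symmetryAt g z = g := fun z => by simp [symmetryAt, mul_assoc]
  simp only [hc, inv_mul_cancel_right, mul_inv_cancel, one_mul, modelDeriv_id, modelDeriv_const,
    ContinuousLinearMap.id_comp] at h
  exact eq_neg_of_add_eq_zero_right h.symm

theorem pullback_symmetryAt_maurerCartanLeft (g x : G) :
    ((maurerCartanLeft I G).pullback (J := I) (symmetryAt g) x : E →L[ℝ] E) =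
      (modelDeriv I I (fun w : G => g⁻¹ * w⁻¹ * g) 1).comp
        (modelDeriv I I (fun z : G => z * x⁻¹) x) := by
  have hc : ContMDiff I I ∞ (fun w : G => g⁻¹ * w⁻¹ * g) :=
    (contMDiff_const.mul contMDiff_id.inv).mul contMDiff_const
  have h' := modelDeriv_comp (I := I) (f := fun z : G => z * x⁻¹)
    (g := fun w : G => g⁻¹ * w⁻¹ * g) (mul_inv_cancel x) (hc.mdifferentiable (by simp) 1)
    ((contMDiff_mul_right_const (I := I) x⁻¹).mdifferentiable (by simp) x)
  have h := modelDeriv_comp (I := I) (g := fun z : G => (symmetryAt g x)⁻¹ * z)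
    (f := symmetryAt g) (x := x) rfl
    ((contMDiff_mul_left_const (I := I) (symmetryAt g x)⁻¹).mdifferentiable (by simp) _)
    ((contMDiff_symmetryAt (I := I) g).mdifferentiable (by simp) x)
  have hz : (fun z : G => (symmetryAt g x)⁻¹ * symmetryAt g z) =
      fun z : G => g⁻¹ * (z * x⁻¹)⁻¹ * g := by
    funext z
    simp [symmetryAt, mul_assoc]
  rw [hz, h'] at h
  exact h.symm

end Group

section Cancellation

variable {E : Type*} [NormedAddCommGroup E] [NormedSpace ℝ E]
  {H : Type*} [TopologicalSpace H] {I : ModelWithCorners ℝ E H}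
  {M : Type*} [TopologicalSpace M] [ChartedSpace H M]
  {F : Type*} [NormedAddCommGroup F] [NormedSpace ℝ F]
  {F' : Type*} [NormedAddCommGroup F'] [NormedSpace ℝ F']
  {G : Type*} [TopologicalSpace G] [ChartedSpace H G] [Group G] [LieGroup I ∞ G]

theorem extDerivOneForm_clm_comp_apply [I.Boundaryless] [IsManifold I 1 M] (B : F →L[ℝ] F')
    {α : OneForm I M F} {β : OneForm I M F'} {x : M}
    (hβ : ∀ y, (β y : E →L[ℝ] F') = B.comp (α y : E →L[ℝ] F)) (hα : α.DiffAt x)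
    (v : Fin 2 → E) :
    (extDerivOneForm I β x : E [⋀^Fin 2]→L[ℝ] F') v =
      B ((extDerivOneForm I α x : E [⋀^Fin 2]→L[ℝ] F) v) := by
  have h : β.inChart x = fun y => B.comp (α.inChart x y) := by
    funext y
    rw [OneForm.inChart, hβ]
    rfl
  rw [extDerivOneForm_apply, extDerivOneForm_apply, h,
    fderiv_clm_comp (differentiableAt_const B) hα]
  simp

theorem alternating_two_apply_neg (η : E [⋀^Fin 2]→L[ℝ] F) (v : Fin 2 → E) :
    η (fun i => (-ContinuousLinearMap.id ℝ E) (v i)) = η v := by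
  have h := η.toContinuousMultilinearMap.map_smul_univ (fun _ => (-1 : ℝ)) v
  simpa using h

theorem extDerivOneForm_maurerCartan_cancel [I.Boundaryless] (g : G) (v : Fin 2 → E) :
    (modelDeriv I I (fun x : G => x * g⁻¹) g).inverse
        ((extDerivOneForm I (maurerCartanRight I G) g : E [⋀^Fin 2]→L[ℝ] E) v) +
      (modelDeriv I I (fun x : G => g⁻¹ * x) g).inverse
        ((extDerivOneForm I (maurerCartanLeft I G) g : E [⋀^Fin 2]→L[ℝ] E) v) = 0 := by
  obtain ⟨B, hB⟩ : ∃ B : E →L[ℝ] E, B = modelDeriv I I (fun w : G => g⁻¹ * w⁻¹ * g) 1 :=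
    ⟨_, rfl⟩
  have hpull : ∀ x : G, ((maurerCartanLeft I G).pullback (J := I) (symmetryAt g) x : E →L[ℝ] E) =
      B.comp (maurerCartanRight I G x : E →L[ℝ] E) := fun x => by
    rw [hB]
    exact pullback_symmetryAt_maurerCartanLeft g x
  have hd₁ := extDerivOneForm_clm_comp_apply B hpull (smoothAt_maurerCartanRight g).diffAt v
  have hd₂ := extDerivOneForm_pullback_apply (symmetryAt_self g)
    ((contMDiff_symmetryAt (I := I) g).contMDiffAt.of_le (WithTop.coe_le_coe.2 le_top))
    (smoothAt_maurerCartanLeft g).diffAt (modelDeriv_symmetryAt_self g) v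
  replace hd₂ := hd₂.trans (alternating_two_apply_neg _ v)
  obtain ⟨R, hR⟩ : ∃ R : E →L[ℝ] E, R = modelDeriv I I (fun x : G => x * g⁻¹) g := ⟨_, rfl⟩
  obtain ⟨L, hL⟩ : ∃ L : E →L[ℝ] E, L = modelDeriv I I (fun x : G => g⁻¹ * x) g := ⟨_, rfl⟩
  have hBR : B.comp R = -L := by
    have hL' : (maurerCartanLeft I G (symmetryAt g g) : E →L[ℝ] E) = L := by
      rw [symmetryAt_self, hL]
      rfl
    have h : L.comp (modelDeriv I I (symmetryAt g) g) = B.comp R := by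
      rw [← hL', hR]
      exact hpull g
    rw [← h, modelDeriv_symmetryAt_self, ContinuousLinearMap.comp_neg,
      ContinuousLinearMap.comp_id]
  have hRi : R.IsInvertible := hR ▸ isInvertible_modelDeriv_mul_right g⁻¹ g
  have hLi : L.IsInvertible := hL ▸ isInvertible_modelDeriv_mul_left g⁻¹ g
  have key : ∀ r l : E, l = B r → R.inverse r + L.inverse l = 0 := by
    intro r l hl
    obtain ⟨w, rfl⟩ := hRi.surjective r
    have hBw : B (R w) = -L w := DFunLike.congr_fun hBR w
    rw [hl, hBw, hRi.inverse_apply_self, map_neg, hLi.inverse_apply_self, add_neg_cancel]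
  subst hR hL
  exact key _ _ (hd₂.symm.trans hd₁)

end Cancellation

section Main

variable {E : Type*} [NormedAddCommGroup E] [NormedSpace ℝ E]
  {H : Type*} [TopologicalSpace H] {I : ModelWithCorners ℝ E H}
  {G : Type*} [TopologicalSpace G] [ChartedSpace H G] [Group G] [LieGroup I ∞ G]

theorem liouvilleForm_eq_pairing_momentumLeft :
    liouvilleForm I G =
      pairing (momentumLeft I G) ((maurerCartanRight I G).pullback (cotangentProj I G)) := by
  funext ξ
  refine ContinuousLinearMap.ext fun V => ?_
  exact congrArg ξ.2 ((isInvertible_modelDeriv_mul_right (I := I) ξ.1⁻¹ ξ.1).inverse_apply_self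
    (mfderiv (cotangentModel I) I (cotangentProj I G) ξ V)).symm

theorem liouvilleForm_eq_pairing_momentumRight :
    liouvilleForm I G =
      pairing (momentumRight I G) ((maurerCartanLeft I G).pullback (cotangentProj I G)) := by
  funext ξ
  refine ContinuousLinearMap.ext fun V => ?_
  exact congrArg ξ.2 ((isInvertible_modelDeriv_mul_left (I := I) ξ.1⁻¹ ξ.1).inverse_apply_self
    (mfderiv (cotangentModel I) I (cotangentProj I G) ξ V)).symm

theorem contMDiff_momentumLeft [CompleteSpace E] [I.Boundaryless] :
    ContMDiff (cotangentModel I) 𝓘(ℝ, E →L[ℝ] ℝ) ∞ (momentumLeft I G) :=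
  contMDiff_covector_comp_inverse (smoothAt_maurerCartanRight (I := I))
    fun g => isInvertible_modelDeriv_mul_right (I := I) g⁻¹ g

theorem contMDiff_momentumRight [CompleteSpace E] [I.Boundaryless] :
    ContMDiff (cotangentModel I) 𝓘(ℝ, E →L[ℝ] ℝ) ∞ (momentumRight I G) :=
  contMDiff_covector_comp_inverse (smoothAt_maurerCartanLeft (I := I))
    fun g => isInvertible_modelDeriv_mul_left (I := I) g⁻¹ g

theorem extDerivOneForm_pairing_pullback_apply [I.Boundaryless] {α : OneForm I G E}
    {f : CotangentBundle I G → E →L[ℝ] ℝ}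
    (hf : ContMDiff (cotangentModel I) 𝓘(ℝ, E →L[ℝ] ℝ) ∞ f) (hα : ∀ g, α.SmoothAt g)
    (ξ : CotangentBundle I G) (v : Fin 2 → E × (E →L[ℝ] ℝ)) :
    (extDerivOneForm (cotangentModel I) (pairing f (α.pullback (cotangentProj I G))) ξ :
        (E × (E →L[ℝ] ℝ)) [⋀^Fin 2]→L[ℝ] ℝ) v =
      (wedgePairing (extDerivFunction (cotangentModel I) f)
        (α.pullback (cotangentProj I G)) ξ : (E × (E →L[ℝ] ℝ)) [⋀^Fin 2]→L[ℝ] ℝ) v +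
      f ξ ((extDerivOneForm I α ξ.1 : E [⋀^Fin 2]→L[ℝ] E)
        (fun i => modelDeriv (cotangentModel I) I (cotangentProj I G) ξ (v i))) := by
  have hπ : ContMDiffAt (cotangentModel I) I 2 (cotangentProj I G) ξ :=
    (contMDiff_cotangentProj ξ).of_le (WithTop.coe_le_coe.2 le_top)
  exact (extDerivOneForm_pairing_apply (hf.mdifferentiable (by simp) ξ)
    ((hα ξ.1).diffAt.pullback hπ) v).trans (congrArg (fun r => _ + f ξ r)
      (extDerivOneForm_pullback_apply (z := ξ.1) rfl hπ (hα ξ.1).diffAt rfl v))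

theorem extDerivOneForm_liouvilleForm [CompleteSpace E] [I.Boundaryless] :
    extDerivOneForm (cotangentModel I) (liouvilleForm I G) =
      (1 / 2 : ℝ) •
        (wedgePairing (extDerivFunction (cotangentModel I) (momentumLeft I G))
            ((maurerCartanRight I G).pullback (cotangentProj I G)) +
          wedgePairing (extDerivFunction (cotangentModel I) (momentumRight I G))
            ((maurerCartanLeft I G).pullback (cotangentProj I G))) := by
  funext ξ
  refine ContinuousAlternatingMap.ext fun v => ?_
  have hl := extDerivOneForm_pairing_pullback_apply (I := I) contMDiff_momentumLeft
    smoothAt_maurerCartanRight ξ v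
  have hr := extDerivOneForm_pairing_pullback_apply (I := I) contMDiff_momentumRight
    smoothAt_maurerCartanLeft ξ v
  rw [← liouvilleForm_eq_pairing_momentumLeft] at hl
  rw [← liouvilleForm_eq_pairing_momentumRight] at hr
  have hc := congrArg (covector ξ) (extDerivOneForm_maurerCartan_cancel (I := I) ξ.1
    (fun i => modelDeriv (cotangentModel I) I (cotangentProj I G) ξ (v i)))
  rw [map_add, map_zero] at hc
  have hsum : ∀ {t a b c d : ℝ}, t = a + c → t = b + d → c + d = 0 → t = 1 / 2 * (a + b) := by
    intros
    linarith
  exact hsum hl hr hc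

end Main

end LieCotangent

end

open LieCotangent in
theorem mainTheorem1
    {E : Type*} [NormedAddCommGroup E] [NormedSpace ℝ E] [FiniteDimensional ℝ E]
    {H : Type*} [TopologicalSpace H] (I : ModelWithCorners ℝ E H) [I.Boundaryless]
    (G : Type*) [TopologicalSpace G] [ChartedSpace H G] [Group G] [LieGroup I ∞ G] :
    IsSmoothOneForm (cotangentModel I) (liouvilleForm I G) ∧
    ContMDiff (cotangentModel I) 𝓘(ℝ, E →L[ℝ] ℝ) ∞ (momentumLeft I G) ∧
    ContMDiff (cotangentModel I) 𝓘(ℝ, E →L[ℝ] ℝ) ∞ (momentumRight I G) ∧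
    liouvilleForm I G =
      pairing (momentumLeft I G) ((maurerCartanRight I G).pullback (cotangentProj I G)) ∧
    liouvilleForm I G =
      pairing (momentumRight I G) ((maurerCartanLeft I G).pullback (cotangentProj I G)) ∧
    canonicalSymplecticForm I G = extDerivOneForm (cotangentModel I) (liouvilleForm I G) ∧
    extDerivOneForm (cotangentModel I) (liouvilleForm I G) =
      (1 / 2 : ℝ) •
        (wedgePairing (extDerivFunction (cotangentModel I) (momentumLeft I G))
            ((maurerCartanRight I G).pullback (cotangentProj I G)) +
          wedgePairing (extDerivFunction (cotangentModel I) (momentumRight I G))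
            ((maurerCartanLeft I G).pullback (cotangentProj I G))) := by
  have : CompleteSpace E := FiniteDimensional.complete ℝ E
  exact ⟨isSmoothOneForm_liouvilleForm, contMDiff_momentumLeft, contMDiff_momentumRight,
    liouvilleForm_eq_pairing_momentumLeft, liouvilleForm_eq_pairing_momentumRight, rfl,
    extDerivOneForm_liouvilleForm⟩
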